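/- Write $IV=\{1,2,3,4\}$ for the set of ontic states of a toy bit. A state of $n$ toy bits is represented by a subset of $IV^n$. Diagrams are interpreted as relations; connecting diagrams is relational composition. The generators are as follows. - The green node with one input and two outputs is the relation $1\sim\{(1,1),(2,2)\}$, $2\sim\{(1,2),(2,1)\}$, $3\sim\{(3,3),(4,4)\}$, $4\sim\{(3,4),(4,3)\}$, and the green node with two inputs and one output is its converse. - The green one-output nodes with phase labels $00,01,10,11$ are the states $\{1,3\},\{1,4\},\{2,3\},\{2,4\}$. The green node with one input, no output and label $00$ is the converse of the first of these. - A green spider with any number of inputs and outputs and phase label $xy$ joins all its inputs together with the green state $xy$, and then splits the result into its outputs. - The yellow node $H$ is the permutation $(2\,3)$ of $IV$. - A red spider is the green spider with the same label and with $H$ on each input and output. A *phase shift* is a spider with one input and one output. A *GS-LO diagram* on $n$ toy bits consists of a simple graph on the vertex set $\{1,\dots,n\}$, drawn as one unlabelled (i.e. label $00$) green node with one output per vertex and one node $H$ per edge, connected to the green nodes of the two end points, together with, on each output, a reversible single-toy-bit operator (a chain of phase shifts and $H$ nodes), called the vertex operator. It is in *reduced GS-LO (rGS-LO) form* if 1.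 every vertex operator is either a green phase shift $ab$ with $a,b\in\{0,1\}$, or a green phase shift $e\bar e$ (next to the graph state) followed by a red phase shift $01$, with $e\in\{0,1\}$ and $\bar e=e\oplus 1$; and 2. no two adjacent vertices both have vertex operators that contain a red node. A pair $(D_1,D_2)$ of rGS-LO diagrams on the same number $n$ of toy bits is *simplified* if there are no toy bits $p,q$ such that $p$ has a red node in its vertex operator in $D_1$ but not in $D_2$, $q$ has a red node in its vertex operator in $D_2$ but not in $D_1$, and $p$ and $q$ are adjacent in at least one of the two diagrams. **Theorem.** Let $(D_1,D_2)$ be a simplified pair of rGS-LO diagrams on $n$ toy bits. Then $D_1$ and $D_2$ denote the same toy state, i.e. the same subset of $IV^n$, if and only if they are identical, i.e. they have the same graph and, at each toy bit, the same vertex operator. -/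

import Mathlib

namespace Spekkens

/-- The four ontic states of a single toy bit. -/
inductive Ontic where
  | s1 | s2 | s3 | s4
  deriving DecidableEq

open Ontic

instance : Fintype Ontic where
  elems := {s1, s2, s3, s4}
  complete := by intro a; cases a <;> decide

/-- The relation `a ~ (b, c)` denoted by the green node with one input and two outputs. -/
def greenSplit : Finset (Ontic × Ontic × Ontic) :=
  {(s1, s1, s1), (s1, s2, s2),
   (s2, s1, s2), (s2, s2, s1),
   (s3, s3, s3), (s3, s4, s4),
   (s4, s3, s4), (s4, s4, s3)}

/-- The state denoted by the green node with one output and phase label `xy`. -/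
def greenState : Bool → Bool → Finset Ontic
  | false, false => {s1, s3}
  | false, true => {s1, s4}
  | true, false => {s2, s3}
  | true, true => {s2, s4}

/-- The relation denoted by the yellow (Hadamard-like) node. -/
def hadamard : Finset (Ontic × Ontic) :=
  {(s1, s1), (s2, s3), (s3, s2), (s4, s4)}

/-- The relation `a ~ l` denoted by the phase-free green spider with one input and
`l.length` outputs: the converse of the green `00` state if there are no outputs, a wire if there
is one, and an iterated `greenSplit` otherwise. -/
def greenFan (a : Ontic) : List Ontic → Prop
  | [] => a ∈ greenState false false
  | [b] => a = b
  | b :: c :: l => ∃ d, (a, b, d) ∈ greenSplit ∧ greenFan d (c :: l)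

/-- The relation denoted by the green spider with phase label `xy`: the inputs are joined (the
converse of splitting), the result is joined with the green state `xy`, and then split into the
outputs. -/
def greenSpider (x y : Bool) (ins outs : List Ontic) : Prop :=
  ∃ a p b, greenFan a ins ∧ p ∈ greenState x y ∧ (b, a, p) ∈ greenSplit ∧ greenFan b outs

/-- The relation denoted by the red spider with phase label `xy`: a green spider with a copy of
the yellow node on all inputs and outputs. -/
def redSpider (x y : Bool) (ins outs : List Ontic) : Prop :=
  ∃ ins' outs', List.Forall₂ (fun a b => (a, b) ∈ hadamard) ins ins' ∧
    greenSpider x y ins' outs' ∧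
    List.Forall₂ (fun a b => (a, b) ∈ hadamard) outs' outs

/-- The nodes from which reversible single-toy-bit operators are composed: green and red phase
shifts with phase label `xy`, and the yellow node. -/
inductive LocalNode where
  | green (x y : Bool)
  | red (x y : Bool)
  | had
  deriving DecidableEq

/-- The relation on a single toy bit denoted by one node. -/
def LocalNode.rel : LocalNode → Ontic → Ontic → Prop
  | .green x y, a, b => greenSpider x y [a] [b]
  | .red x y, a, b => redSpider x y [a] [b]
  | .had, a, b => (a, b) ∈ hadamard

/-- A diagram of a reversible single-toy-bit operator: a chain of nodes, listed from input to
output (from bottom to top). -/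
abbrev LocalOp := List LocalNode

/-- The relation denoted by a chain of nodes (the empty chain is a plain wire). -/
def LocalOp.rel : LocalOp → Ontic → Ontic → Prop
  | [], a, b => a = b
  | N :: w, a, b => ∃ c, N.rel a c ∧ LocalOp.rel w c b

/-- The diagram contains a red node. -/
def LocalOp.HasRed (w : LocalOp) : Prop := ∃ x y, LocalNode.red x y ∈ w

/-- The set of reduced vertex operators: the green phase shifts `ab`, and the green phase shifts
with label `e ē` (where `ē = e ⊕ 1`) followed by the red phase shift `01`. -/
def reducedOps : Set LocalOp :=
  {w | (∃ a b : Bool, w = [LocalNode.green a b]) ∨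
    ∃ e : Bool, w = [LocalNode.green e (!e), LocalNode.red false true]}

open Classical in
/-- The toy state denoted by the graph state diagram of `G`, as a set of ontic states. Vertex `p`
carries a phase-free green node, connected to the output wire `p` and, for each neighbour `q`, to
a wire (with ontic state `leg p q`) that leads to the yellow node on the edge `{p, q}`. Composition
of relations and bending of wires amount to an existential quantification over the ontic states of
all internal wires. -/
noncomputable def graphState {n : ℕ} (G : SimpleGraph (Fin n)) : Set (Fin n → Ontic) :=
  {v | ∃ leg : Fin n → Fin n → Ontic,
    (∀ p, greenSpider false false []
      (v p :: ((List.finRange n).filter (fun q => G.Adj p q)).map (leg p))) ∧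
    ∀ p q, p < q → G.Adj p q → (leg p q, leg q p) ∈ hadamard}

/-- A GS-LO diagram on `n` toy bits: a graph state, with a reversible single-toy-bit operator on
each output. -/
@[ext]
structure GSLO (n : ℕ) where
  graph : SimpleGraph (Fin n)
  op : Fin n → LocalOp

namespace GSLO

/-- The toy state denoted by a GS-LO diagram, as a set of ontic states of `n` toy bits. -/
noncomputable def interp {n : ℕ} (D : GSLO n) : Set (Fin n → Ontic) :=
  {w | ∃ v ∈ graphState D.graph, ∀ p, (D.op p).rel (v p) (w p)}

/-- Reduced GS-LO form. -/
structure IsReduced {n : ℕ} (D : GSLO n) : Prop where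
  op_mem : ∀ p, D.op p ∈ reducedOps
  not_adj : ∀ p q, D.graph.Adj p q → ¬ ((D.op p).HasRed ∧ (D.op q).HasRed)

/-- The condition for a pair of reduced GS-LO diagrams to be simplified. -/
def IsSimplifiedPair {n : ℕ} (D₁ D₂ : GSLO n) : Prop :=
  D₁.IsReduced ∧ D₂.IsReduced ∧
    ¬ ∃ p q, ((D₁.op p).HasRed ∧ ¬ (D₂.op p).HasRed) ∧
      ((D₂.op q).HasRed ∧ ¬ (D₁.op q).HasRed) ∧
      (D₁.graph.Adj p q ∨ D₂.graph.Adj p q)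

end GSLO

end Spekkens

/-!
Identify the ontic states with `𝔽₂ × 𝔽₂` through `s1 = (0,0)`, `s2 = (0,1)`, `s3 = (1,0)`,
`s4 = (1,1)`, and write `(x, z)` for the two coordinates. All relations become affine: a green
spider forces all `x` to agree and fixes the sum of all `z` (`greenSpider_iff`), the yellow node
swaps the coordinates, and the graph state of `G` is `{z p = ∑ q ∼ p, x q}`
(`mem_graphState_iff`), freely parametrised by `x`. On a reduced vertex operator, the parameter
`x p` is the first output coordinate if there is no red node, and the sum of both output
coordinates if there is one; in the latter case the first output coordinate is
`e + ∑ q ∼ p, x q`.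

Suppose two diagrams of a simplified pair denote the same state. If `p` had a red node in `D₁`
only, then by reducedness and simplification no neighbour of `p` in `D₁` has a red node in either
diagram. So the state satisfies an affine equation between the first coordinates at `p` and its
neighbours, while in `D₂` these coordinates are free: a contradiction (`hasRed_of_interp_subset`).
Hence the same vertices have red nodes in both diagrams, the parameter `x` is the same
function of the ontic state for both, and both diagrams express the remaining coordinate at each
`p` as the same affine function of `x`. Its coefficients determine the neighbourhood of `p` and the
phase labels (`coeff_eq_of_affine_eq`).
-/

namespace Spekkens

open Ontic

/-! ### Coordinates on the ontic states -/

/-- The first `𝔽₂`-coordinate of an ontic state, which distinguishes `{1, 2}` from `{3, 4}`; it is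
the one that the green nodes copy. -/
def Ontic.xc : Ontic → ZMod 2
  | s1 => 0
  | s2 => 0
  | s3 => 1
  | s4 => 1

/-- The second `𝔽₂`-coordinate of an ontic state, which distinguishes `{1, 3}` from `{2, 4}`; it is
the one that the green nodes add up. -/
def Ontic.zc : Ontic → ZMod 2
  | s1 => 0
  | s2 => 1
  | s3 => 0
  | s4 => 1

/-- A Boolean phase label as an element of `𝔽₂`. -/
def bit : Bool → ZMod 2
  | false => 0
  | true => 1

theorem bit_injective : Function.Injective bit := by decide

theorem Ontic.ext_coord {a b : Ontic} (hx : a.xc = b.xc) (hz : a.zc = b.zc) : a = b := by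
  revert a b; decide

theorem Ontic.exists_coord (x z : ZMod 2) : ∃ a : Ontic, a.xc = x ∧ a.zc = z := by
  revert x z; decide

theorem mem_greenSplit_iff (a b c : Ontic) :
    (a, b, c) ∈ greenSplit ↔ b.xc = a.xc ∧ c.xc = a.xc ∧ a.zc = b.zc + c.zc := by
  revert a b c; decide

theorem mem_greenState_iff (x y : Bool) (p : Ontic) :
    p ∈ greenState x y ↔ p.zc = bit x + (bit x + bit y) * p.xc := by
  revert x y p; decide

theorem mem_hadamard_iff (a b : Ontic) :
    (a, b) ∈ hadamard ↔ b.xc = a.zc ∧ b.zc = a.xc := by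
  revert a b; decide

/-! ### Spiders and vertex operators in coordinates -/

theorem greenFan_iff (a : Ontic) (l : List Ontic) :
    greenFan a l ↔ (∀ b ∈ l, b.xc = a.xc) ∧ a.zc = (l.map Ontic.zc).sum := by
  induction l generalizing a with
  | nil => simp [greenFan, mem_greenState_iff, bit]
  | cons b l ih =>
    cases l with
    | nil =>
      simp only [greenFan, List.mem_singleton, forall_eq, List.map_cons, List.map_nil,
        List.sum_cons, List.sum_nil, add_zero]
      exact ⟨fun h => h ▸ ⟨rfl, rfl⟩, fun h => Ontic.ext_coord h.1.symm h.2⟩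
    | cons c l =>
      rw [greenFan, List.forall_mem_cons, List.map_cons, List.sum_cons]
      constructor
      · rintro ⟨d, hd, hl⟩
        obtain ⟨hb, hda, hz⟩ := (mem_greenSplit_iff _ _ _).1 hd
        obtain ⟨hx, hs⟩ := (ih d).1 hl
        exact ⟨⟨hb, fun e he => (hx e he).trans hda⟩, by rw [hz, hs]⟩
      · rintro ⟨⟨hb, hx⟩, hz⟩
        obtain ⟨d, hdx, hdz⟩ := Ontic.exists_coord a.xc ((c :: l).map Ontic.zc).sum
        exact ⟨d, (mem_greenSplit_iff _ _ _).2 ⟨hb, hdx, by rw [hz, hdz]⟩,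
          (ih d).2 ⟨fun e he => (hx e he).trans hdx.symm, hdz⟩⟩

theorem greenSpider_iff (x y : Bool) (ins outs : List Ontic) :
    greenSpider x y ins outs ↔ ∃ t : ZMod 2, (∀ a ∈ ins, a.xc = t) ∧ (∀ b ∈ outs, b.xc = t) ∧
      (outs.map Ontic.zc).sum = (ins.map Ontic.zc).sum + (bit x + (bit x + bit y) * t) := by
  simp only [greenSpider, greenFan_iff, mem_greenState_iff, mem_greenSplit_iff]
  constructor
  · rintro ⟨a, p, b, ⟨hi, ha⟩, hp, ⟨hab, hpb, hb⟩, ho, hb'⟩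
    exact ⟨b.xc, fun c hc => (hi c hc).trans hab, ho, by rw [← hb', hb, ← ha, hp, hpb]⟩
  · rintro ⟨t, hi, ho, hs⟩
    obtain ⟨a, hax, haz⟩ := Ontic.exists_coord t (ins.map Ontic.zc).sum
    obtain ⟨p, hpx, hpz⟩ := Ontic.exists_coord t (bit x + (bit x + bit y) * t)
    obtain ⟨b, hbx, hbz⟩ := Ontic.exists_coord t (outs.map Ontic.zc).sum
    exact ⟨a, p, b, ⟨by simpa [hax] using hi, haz⟩, by rw [hpz, hpx],
      ⟨by rw [hax, hbx], by rw [hpx, hbx], by rw [hbz, haz, hpz, hs]⟩,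
      by simpa [hbx] using ho, hbz⟩

theorem greenPhase_iff (x y : Bool) (a b : Ontic) :
    (LocalNode.green x y).rel a b ↔
      b.xc = a.xc ∧ b.zc = a.zc + (bit x + (bit x + bit y) * a.xc) := by
  simp only [LocalNode.rel, greenSpider_iff, List.mem_singleton, forall_eq, List.map_cons,
    List.map_nil, List.sum_cons, List.sum_nil, add_zero]
  constructor
  · rintro ⟨t, rfl, hb, hz⟩
    exact ⟨hb, hz⟩
  · rintro ⟨hb, hz⟩
    exact ⟨a.xc, rfl, hb, hz⟩

/-- A red phase shift is a green one with the two coordinates exchanged. -/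
theorem redPhase_iff (x y : Bool) (a b : Ontic) :
    (LocalNode.red x y).rel a b ↔
      b.zc = a.zc ∧ b.xc = a.xc + (bit x + (bit x + bit y) * a.zc) := by
  have key : (LocalNode.red x y).rel a b ↔
      ∃ c d, (a, c) ∈ hadamard ∧ (LocalNode.green x y).rel c d ∧ (d, b) ∈ hadamard := by
    simp [LocalNode.rel, redSpider, List.forall₂_cons_left_iff, List.forall₂_cons_right_iff]
  simp only [key, mem_hadamard_iff, greenPhase_iff]
  constructor
  · rintro ⟨c, d, ⟨hcx, hcz⟩, ⟨hdx, hdz⟩, hbx, hbz⟩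
    exact ⟨by rw [hbz, hdx, hcx], by rw [hbx, hdz, hcz, hcx]⟩
  · rintro ⟨hz, hx⟩
    obtain ⟨c, hcx, hcz⟩ := Ontic.exists_coord a.zc a.xc
    obtain ⟨d, hdx, hdz⟩ := Ontic.exists_coord b.zc b.xc
    exact ⟨c, d, ⟨hcx, hcz⟩, ⟨by rw [hdx, hcx, hz], by rw [hdz, hcz, hcx, hx]⟩, hdz.symm,
      hdx.symm⟩

theorem greenOp_iff (x y : Bool) (a b : Ontic) :
    LocalOp.rel [.green x y] a b ↔
      b.xc = a.xc ∧ b.zc = a.zc + (bit x + (bit x + bit y) * a.xc) := by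
  simp [LocalOp.rel, greenPhase_iff]

/-- The reduced vertex operator with a red node turns the second coordinate of its input into the
first coordinate of its output, up to the phase label. -/
theorem greenRedOp_iff (e : Bool) (a b : Ontic) :
    LocalOp.rel [.green e (!e), .red false true] a b ↔
      b.xc = a.zc + bit e ∧ a.xc = b.xc + b.zc := by
  simp only [LocalOp.rel, greenPhase_iff, redPhase_iff, exists_eq_right]
  revert e a b; decide

theorem LocalOp.not_hasRed_green (x y : Bool) : ¬ LocalOp.HasRed [.green x y] := by
  simp [LocalOp.HasRed]

theorem LocalOp.hasRed_greenRed (e : Bool) :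
    LocalOp.HasRed [.green e (!e), .red false true] := by
  simp [LocalOp.HasRed]

theorem exists_green_of_not_hasRed {o : LocalOp} (ho : o ∈ reducedOps) (h : ¬ o.HasRed) :
    ∃ x y, o = [.green x y] := by
  rcases ho with h' | ⟨e, rfl⟩
  · exact h'
  · exact absurd (LocalOp.hasRed_greenRed e) h

theorem exists_greenRed_of_hasRed {o : LocalOp} (ho : o ∈ reducedOps) (h : o.HasRed) :
    ∃ e, o = [.green e (!e), .red false true] := by
  rcases ho with ⟨x, y, rfl⟩ | h'
  · exact absurd h (LocalOp.not_hasRed_green x y)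
  · exact h'

theorem exists_rel_of_mem_reducedOps {o : LocalOp} (ho : o ∈ reducedOps) (a : Ontic) :
    ∃ b, o.rel a b := by
  rcases ho with ⟨x, y, rfl⟩ | ⟨e, rfl⟩
  · obtain ⟨b, hx, hz⟩ :=
      Ontic.exists_coord a.xc (a.zc + (bit x + (bit x + bit y) * a.xc))
    exact ⟨b, (greenOp_iff _ _ _ _).2 ⟨hx, hz⟩⟩
  · obtain ⟨b, hx, hz⟩ := Ontic.exists_coord (a.zc + bit e) (a.xc - (a.zc + bit e))
    exact ⟨b, (greenRedOp_iff _ _ _).2 ⟨hx, by rw [hx, hz]; ring⟩⟩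

/-- Which function of the output gives the first coordinate of the input depends only on the
presence of a red node, not on the phase labels. -/
theorem xc_eq_of_rel {o₁ o₂ : LocalOp} (h₁ : o₁ ∈ reducedOps) (h₂ : o₂ ∈ reducedOps)
    (h : o₁.HasRed ↔ o₂.HasRed) {a₁ a₂ b : Ontic} (r₁ : o₁.rel a₁ b) (r₂ : o₂.rel a₂ b) :
    a₁.xc = a₂.xc := by
  by_cases hr : o₁.HasRed
  · obtain ⟨e₁, rfl⟩ := exists_greenRed_of_hasRed h₁ hr
    obtain ⟨e₂, rfl⟩ := exists_greenRed_of_hasRed h₂ (h.1 hr)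
    rw [greenRedOp_iff] at r₁ r₂
    rw [r₁.2, r₂.2]
  · obtain ⟨x₁, y₁, rfl⟩ := exists_green_of_not_hasRed h₁ hr
    obtain ⟨x₂, y₂, rfl⟩ := exists_green_of_not_hasRed h₂ (mt h.2 hr)
    rw [greenOp_iff] at r₁ r₂
    rw [← r₁.1, ← r₂.1]

theorem xc_eq_of_rel_of_not_hasRed {o : LocalOp} (ho : o ∈ reducedOps) (h : ¬ o.HasRed)
    {a b : Ontic} (r : o.rel a b) : b.xc = a.xc := by
  obtain ⟨x, y, rfl⟩ := exists_green_of_not_hasRed ho h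
  exact ((greenOp_iff _ _ _ _).1 r).1

/-! ### Graph states in coordinates -/

open Classical in
/-- The sum of the values of `x` over the neighbours of `p`. -/
noncomputable def neighborSum {n : ℕ} (G : SimpleGraph (Fin n)) (x : Fin n → ZMod 2)
    (p : Fin n) : ZMod 2 :=
  ∑ q, if G.Adj p q then x q else 0

theorem neighborSum_congr {n : ℕ} {G : SimpleGraph (Fin n)} {x y : Fin n → ZMod 2} {p : Fin n}
    (h : ∀ q, G.Adj p q → x q = y q) : neighborSum G x p = neighborSum G y p := by
  refine Finset.sum_congr rfl fun q _ => ?_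
  split_ifs with hq
  · exact h q hq
  · rfl

theorem neighborSum_zero {n : ℕ} (G : SimpleGraph (Fin n)) (p : Fin n) :
    neighborSum G 0 p = 0 := by
  simp [neighborSum]

open Classical in
theorem neighborSum_single {n : ℕ} (G : SimpleGraph (Fin n)) (p q : Fin n) :
    neighborSum G (Pi.single q 1) p = if G.Adj p q then 1 else 0 := by
  unfold neighborSum
  rw [Finset.sum_eq_single q]
  · simp
  · intro r _ hr
    simp [hr]
  · simp

open Classical in
theorem sum_map_filter_finRange {n : ℕ} (P : Fin n → Prop) (f : Fin n → ZMod 2) :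
    (((List.finRange n).filter (fun q => P q)).map f).sum = ∑ q, if P q then f q else 0 := by
  rw [← Finset.sum_filter, ← List.sum_toFinset _ ((List.nodup_finRange n).filter _)]
  refine Finset.sum_congr ?_ fun _ _ => rfl
  ext q
  simp

theorem mem_graphState_iff {n : ℕ} (G : SimpleGraph (Fin n)) (v : Fin n → Ontic) :
    v ∈ graphState G ↔ ∀ p, (v p).zc = neighborSum G (fun q => (v q).xc) p := by
  classical
  have key : ∀ (leg : Fin n → Fin n → Ontic) (p : Fin n), greenSpider false false []
      (v p :: ((List.finRange n).filter (fun q => G.Adj p q)).map (leg p)) ↔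
      (∀ q, G.Adj p q → (leg p q).xc = (v p).xc) ∧
        (v p).zc = ∑ q, if G.Adj p q then (leg p q).zc else 0 := by
    intro leg p
    rw [greenSpider_iff]
    simp only [List.forall_mem_cons, List.forall_mem_map, List.map_cons, List.map_map,
      List.sum_cons, Function.comp_def]
    rw [sum_map_filter_finRange (G.Adj p) (fun q => (leg p q).zc)]
    simp only [bit, List.map_nil, List.sum_nil, add_zero, zero_mul, List.not_mem_nil,
      false_imp_iff, implies_true, true_and, List.mem_filter, List.mem_finRange,
      decide_eq_true_eq, CharTwo.add_eq_zero]
    constructor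
    · rintro ⟨t, ⟨rfl, h⟩, hs⟩
      exact ⟨h, hs⟩
    · rintro ⟨h, hs⟩
      exact ⟨_, ⟨rfl, h⟩, hs⟩
  have unfold_mem : v ∈ graphState G ↔ ∃ leg : Fin n → Fin n → Ontic,
      (∀ p, greenSpider false false []
        (v p :: ((List.finRange n).filter (fun q => G.Adj p q)).map (leg p))) ∧
      ∀ p q, p < q → G.Adj p q → (leg p q, leg q p) ∈ hadamard := Iff.rfl
  rw [unfold_mem]
  simp only [key, mem_hadamard_iff]
  constructor
  · rintro ⟨leg, hleg, hh⟩ p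
    rw [(hleg p).2]
    refine Finset.sum_congr rfl fun q _ => ?_
    split_ifs with hpq
    · rcases lt_or_gt_of_ne hpq.ne with hlt | hlt
      · rw [← (hh p q hlt hpq).1, (hleg q).1 p hpq.symm]
      · rw [(hh q p hlt hpq.symm).2, (hleg q).1 p hpq.symm]
    · rfl
  · intro h
    choose leg hx hz using fun p q => Ontic.exists_coord (v p).xc (v q).xc
    refine ⟨leg, fun p => ⟨fun q _ => hx p q, ?_⟩, fun p q _ _ => ⟨?_, ?_⟩⟩
    · simp only [hz, h p, neighborSum]
    · rw [hx, hz]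
    · rw [hx, hz]

namespace GSLO

variable {n : ℕ}

/-- Every assignment `x` of first coordinates to the vertices extends to an ontic state in the
graph state, hence to one of the diagram. -/
theorem IsReduced.exists_mem_interp {D : GSLO n} (hD : D.IsReduced) (x : Fin n → ZMod 2) :
    ∃ v w : Fin n → Ontic, w ∈ D.interp ∧ (∀ p, (v p).xc = x p) ∧
      (∀ p, (v p).zc = neighborSum D.graph x p) ∧ ∀ p, (D.op p).rel (v p) (w p) := by
  choose v hx hz using fun p => Ontic.exists_coord (x p) (neighborSum D.graph x p)
  choose w hw using fun p => exists_rel_of_mem_reducedOps (hD.op_mem p) (v p)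
  refine ⟨v, w, ⟨v, (mem_graphState_iff _ _).2 fun p => ?_, hw⟩, hx, hz, hw⟩
  simp only [hx, hz]

/-! ### Comparison of two reduced diagrams -/

theorem hasRed_of_interp_subset {D₁ D₂ : GSLO n} (h₁ : D₁.IsReduced) (h₂ : D₂.IsReduced)
    (hsub : D₂.interp ⊆ D₁.interp) {p : Fin n} (hp : (D₁.op p).HasRed)
    (hadj : ∀ q, D₁.graph.Adj p q → (D₂.op q).HasRed → (D₁.op q).HasRed) :
    (D₂.op p).HasRed := by
  by_contra hp₂
  obtain ⟨e, he⟩ := exists_greenRed_of_hasRed (h₁.op_mem p) hp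
  have key : ∀ x : Fin n → ZMod 2, x p = neighborSum D₁.graph x p + bit e := by
    intro x
    obtain ⟨v, w, hw, hvx, -, hvw⟩ := h₂.exists_mem_interp x
    obtain ⟨u, hu, huw⟩ := hsub hw
    rw [mem_graphState_iff] at hu
    have hup := huw p
    rw [he, greenRedOp_iff, hu p] at hup
    rw [← hvx p, ← xc_eq_of_rel_of_not_hasRed (h₂.op_mem p) hp₂ (hvw p), hup.1]
    congr 1
    refine neighborSum_congr fun q hq => ?_
    have hq₁ : ¬ (D₁.op q).HasRed := fun hr => h₁.not_adj p q hq ⟨hp, hr⟩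
    have hq₂ : ¬ (D₂.op q).HasRed := fun hr => hq₁ (hadj q hq hr)
    rw [← hvx q, ← xc_eq_of_rel_of_not_hasRed (h₁.op_mem q) hq₁ (huw q),
      xc_eq_of_rel_of_not_hasRed (h₂.op_mem q) hq₂ (hvw q)]
  -- The equation cannot hold both at `x = 0` and at the indicator of `p`.
  have h0 := key 0
  have h1 := key (Pi.single p 1)
  rw [neighborSum_zero, zero_add] at h0
  rw [neighborSum_single, ← h0] at h1
  simp at h1

/-- The coefficients of an affine function on `𝔽₂ⁿ`, split into the constant, the coefficient at
`p` and the neighbourhood of `p`, are determined by the function. -/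
theorem coeff_eq_of_affine_eq {G₁ G₂ : SimpleGraph (Fin n)} {p : Fin n} {c₁ c₂ d₁ d₂ : ZMod 2}
    (h : ∀ x : Fin n → ZMod 2,
      neighborSum G₁ x p + (c₁ + d₁ * x p) = neighborSum G₂ x p + (c₂ + d₂ * x p)) :
    c₁ = c₂ ∧ d₁ = d₂ ∧ ∀ q, G₁.Adj p q ↔ G₂.Adj p q := by
  have hc : c₁ = c₂ := by simpa [neighborSum_zero] using h 0
  have hd : d₁ = d₂ := by simpa [neighborSum_single, hc] using h (Pi.single p 1)
  refine ⟨hc, hd, fun q => ?_⟩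
  have hq := h (Pi.single q 1)
  rw [hc, hd, neighborSum_single, neighborSum_single, add_left_inj] at hq
  by_cases h₁ : G₁.Adj p q <;> by_cases h₂ : G₂.Adj p q <;> simp_all

theorem IsSimplifiedPair.symm {D₁ D₂ : GSLO n} (h : IsSimplifiedPair D₁ D₂) :
    IsSimplifiedPair D₂ D₁ := by
  refine ⟨h.2.1, h.1, ?_⟩
  rintro ⟨p, q, hp, hq, hadj⟩
  exact h.2.2 ⟨q, p, hq, hp, hadj.symm.imp SimpleGraph.Adj.symm SimpleGraph.Adj.symm⟩

theorem IsSimplifiedPair.hasRed_of_hasRed {D₁ D₂ : GSLO n} (h : IsSimplifiedPair D₁ D₂)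
    (hsub : D₂.interp ⊆ D₁.interp) {p : Fin n} (hp : (D₁.op p).HasRed) :
    (D₂.op p).HasRed := by
  by_contra hp₂
  refine hp₂ (hasRed_of_interp_subset h.1 h.2.1 hsub hp fun q hq hq₂ => ?_)
  by_contra hq₁
  exact h.2.2 ⟨p, q, ⟨hp, hp₂⟩, ⟨hq₂, hq₁⟩, Or.inl hq⟩

/-- Two reduced diagrams with red nodes at the same vertices that denote the same state have the
same neighbours and the same vertex operator at each vertex. -/
theorem adj_iff_and_op_eq {D₁ D₂ : GSLO n} (h₁ : D₁.IsReduced) (h₂ : D₂.IsReduced)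
    (hsub : D₂.interp ⊆ D₁.interp) (hred : ∀ p, (D₁.op p).HasRed ↔ (D₂.op p).HasRed)
    (p : Fin n) : (∀ q, D₁.graph.Adj p q ↔ D₂.graph.Adj p q) ∧ D₁.op p = D₂.op p := by
  have key : ∀ x : Fin n → ZMod 2, ∃ a₁ a₂ b : Ontic,
      (D₁.op p).rel a₁ b ∧ (D₂.op p).rel a₂ b ∧ a₁.xc = x p ∧ a₂.xc = x p ∧
      a₁.zc = neighborSum D₁.graph x p ∧ a₂.zc = neighborSum D₂.graph x p := by
    intro x
    obtain ⟨v, w, hw, hvx, hvz, hvw⟩ := h₂.exists_mem_interp x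
    obtain ⟨u, hu, huw⟩ := hsub hw
    have hux : ∀ q, (u q).xc = x q := fun q =>
      (xc_eq_of_rel (h₁.op_mem q) (h₂.op_mem q) (hred q) (huw q) (hvw q)).trans (hvx q)
    refine ⟨u p, v p, w p, huw p, hvw p, hux p, hvx p, ?_, hvz p⟩
    rw [(mem_graphState_iff _ _).1 hu p]
    exact neighborSum_congr fun q _ => hux q
  by_cases hr : (D₁.op p).HasRed
  · obtain ⟨e₁, he₁⟩ := exists_greenRed_of_hasRed (h₁.op_mem p) hr
    obtain ⟨e₂, he₂⟩ := exists_greenRed_of_hasRed (h₂.op_mem p) ((hred p).1 hr)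
    have haff : ∀ x : Fin n → ZMod 2, neighborSum D₁.graph x p + (bit e₁ + 0 * x p) =
        neighborSum D₂.graph x p + (bit e₂ + 0 * x p) := by
      intro x
      obtain ⟨a₁, a₂, b, r₁, r₂, -, -, z₁, z₂⟩ := key x
      rw [he₁, greenRedOp_iff, z₁] at r₁
      rw [he₂, greenRedOp_iff, z₂] at r₂
      rw [zero_mul, add_zero, add_zero, ← r₁.1, ← r₂.1]
    obtain ⟨hc, -, hadj⟩ := coeff_eq_of_affine_eq haff
    exact ⟨hadj, by rw [he₁, he₂, bit_injective hc]⟩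
  · obtain ⟨s₁, t₁, he₁⟩ := exists_green_of_not_hasRed (h₁.op_mem p) hr
    obtain ⟨s₂, t₂, he₂⟩ := exists_green_of_not_hasRed (h₂.op_mem p) (mt (hred p).2 hr)
    have haff : ∀ x : Fin n → ZMod 2,
        neighborSum D₁.graph x p + (bit s₁ + (bit s₁ + bit t₁) * x p) =
        neighborSum D₂.graph x p + (bit s₂ + (bit s₂ + bit t₂) * x p) := by
      intro x
      obtain ⟨a₁, a₂, b, r₁, r₂, x₁, x₂, z₁, z₂⟩ := key x
      rw [he₁, greenOp_iff, z₁, x₁] at r₁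
      rw [he₂, greenOp_iff, z₂, x₂] at r₂
      rw [← r₁.2, ← r₂.2]
    obtain ⟨hc, hd, hadj⟩ := coeff_eq_of_affine_eq haff
    rw [hc, add_right_inj] at hd
    exact ⟨hadj, by rw [he₁, he₂, bit_injective hc, bit_injective hd]⟩

end GSLO

end Spekkens

theorem mainTheorem2 {n : ℕ} (D₁ D₂ : Spekkens.GSLO n)
    (h : Spekkens.GSLO.IsSimplifiedPair D₁ D₂) :
    D₁.interp = D₂.interp ↔ D₁ = D₂ := by
  refine ⟨fun heq => ?_, fun heq => heq ▸ rfl⟩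
  have key := Spekkens.GSLO.adj_iff_and_op_eq h.1 h.2.1 heq.ge
    fun p => ⟨h.hasRed_of_hasRed heq.ge, h.symm.hasRed_of_hasRed heq.le⟩
  refine Spekkens.GSLO.ext ?_ (funext fun p => (key p).2)
  ext p q
  exact (key p).1 q
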